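/- (Graham--Leeb--Rothschild theorem) Let $F$ be a finite field. For all $k, n, s \in \mathbb{N} = \{0, 1, 2, \dots\}$ there exists $m \in \mathbb{N}$ such that for every coloring $c$ of the set of $k$-dimensional linear subspaces of $F^m$ with colors $\{0, \dots, s-1\}$ (equivalently, every partition of that set into $s$ classes, some of which may be empty) there exist an $n$-dimensional linear subspace $V$ of $F^m$ and a color $i \in \{0, \dots, s-1\}$ such that $c(W) = i$ for every $k$-dimensional linear subspace $W$ of $F^m$ with $W \subseteq V$. -/

import Mathlib

open Module Combinatorics

universe u v w

section Subspaces

variable {F : Type u} [Field F] {E : Type v} [AddCommGroup E] [Module F E]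

/-! Induction on `k`. By Hales–Jewett (`exists_coloring_factors_through_quotient`) there are `B` and
`e ∉ B` such that subspaces of `B ⊔ ⟨e⟩` avoiding `e` are colored by their image modulo `e`. Those
containing `e` are `T ⊔ ⟨e⟩` with `T ≤ B` of one dimension less, which the induction controls.
`VectorRamsey.succ` merges the two kinds, using a separate target dimension for each color. -/

theorem Submodule.exists_injective_range_le_of_finrank_le {M : Type w} [AddCommGroup M]
    [Module F M] [FiniteDimensional F M] [FiniteDimensional F E] {U : Submodule F E}
    (h : finrank F M ≤ finrank F U) :
    ∃ J : M →ₗ[F] E, Function.Injective J ∧ LinearMap.range J ≤ U := by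
  obtain ⟨f, hf⟩ := finrank_le_iff_exists_linearMap.1 h
  refine ⟨U.subtype ∘ₗ f, U.injective_subtype.comp hf, ?_⟩
  rintro _ ⟨x, rfl⟩
  exact (f x).2

theorem Submodule.exists_le_finrank_eq [FiniteDimensional F E] {U : Submodule F E} {n : ℕ}
    (h : n ≤ finrank F U) : ∃ V ≤ U, finrank F V = n := by
  obtain ⟨J, hJ, hJU⟩ := Submodule.exists_injective_range_le_of_finrank_le
    (M := Fin n → F) (U := U) (by simpa using h)
  exact ⟨_, hJU, by simp [LinearMap.finrank_range_of_inj hJ]⟩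

/-- A subspace of `M × F` not containing `(0, 1)` is the graph of a functional over its
projection to `M`. -/
theorem Submodule.exists_eq_map_prod_of_notMem {M : Type w} [AddCommGroup M] [Module F M]
    {T : Submodule F (M × F)} (hT : ((0, 1) : M × F) ∉ T) :
    ∃ g : M →ₗ[F] F,
      T = (T.map (LinearMap.fst F M F)).map (LinearMap.id.prod g) := by
  have hker : LinearMap.ker ((LinearMap.fst F M F).domRestrict T) = ⊥ := by
    rw [LinearMap.ker_eq_bot']
    rintro ⟨⟨a, z⟩, hm⟩ h0
    obtain rfl : a = 0 := by simpa using h0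
    have hz : z = 0 := by
      by_contra hz
      apply hT
      simpa [hz] using T.smul_mem z⁻¹ hm
    simp [hz]
  obtain ⟨h, hh⟩ := LinearMap.exists_leftInverse_of_injective _ hker
  have key : ∀ t (ht : t ∈ T), (t.1, (h t.1 : M × F).2) = t := fun t ht ↦ by
    have := congrArg (fun x : T ↦ (x : M × F).2) (LinearMap.congr_fun hh ⟨t, ht⟩)
    exact Prod.ext rfl this
  refine ⟨LinearMap.snd F M F ∘ₗ T.subtype ∘ₗ h, le_antisymm ?_ ?_⟩
  · intro t ht
    exact ⟨t.1, ⟨t, ht, rfl⟩, key t ht⟩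
  · rintro _ ⟨_, ⟨t, ht, rfl⟩, rfl⟩
    exact (key t ht).symm ▸ ht

/-- A subspace of `V ⊔ L` containing `L` is determined by its trace on `V`. -/
theorem Submodule.inf_sup_eq_of_le_sup {V L T : Submodule F E} (hL : L ≤ T) (hT : T ≤ V ⊔ L) :
    T ⊓ V ⊔ L = T := by
  rw [inf_sup_assoc_of_le V hL, inf_eq_left.2 hT]

end Subspaces

variable (F : Type u) [Field F] [Finite F]

/-- In a large enough space there are a subspace `B` of prescribed dimension and a vector
`e ∉ B` such that the color of a subspace of `B ⊔ ⟨e⟩` not containing `e` depends only on its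
image modulo `e`. -/
theorem exists_coloring_factors_through_quotient (κ : Type v) [Finite κ] (d : ℕ) :
    ∃ m : ℕ, ∀ (E : Type w) [AddCommGroup E] [Module F E] [FiniteDimensional F E]
      (U : Submodule F E), m ≤ finrank F U → ∀ c : Submodule F E → κ,
      ∃ (B : Submodule F E) (e : E), B ≤ U ∧ e ∈ U ∧ e ∉ B ∧ finrank F B = d ∧
        ∀ T T' : Submodule F E, T ≤ B ⊔ F ∙ e → T' ≤ B ⊔ F ∙ e → e ∉ T → e ∉ T' →
          T ⊔ F ∙ e = T' ⊔ F ∙ e → c T = c T' := by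
  have : Finite ((Fin d → F) →ₗ[F] F) := Finite.of_injective _ DFunLike.coe_injective
  -- Letters are functionals, so a word is a linear map `F^d → F^ι`; its color records `c` on its
  -- graph over every subspace of `F^d` at once.
  obtain ⟨ι, _, hι⟩ := Line.exists_mono_in_high_dimension
    ((Fin d → F) →ₗ[F] F) (Submodule F (Fin d → F) → κ)
  refine ⟨d + Fintype.card ι, fun E _ _ _ U hU c ↦ ?_⟩
  obtain ⟨J, hJ, hJU⟩ := Submodule.exists_injective_range_le_of_finrank_le
    (M := (Fin d → F) × (ι → F)) (U := U) (by simpa using hU)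
  obtain ⟨l, χ, hχ⟩ := hι fun x B ↦ c (B.map (J ∘ₗ LinearMap.id.prod (LinearMap.pi x)))
  -- The variable coordinates of the line `l` all read the extra factor `F`, so `Ψ` carries the
  -- graph of `g` to that of the word `l g`.
  let q : (Fin d → F) × F →ₗ[F] (ι → F) := LinearMap.pi fun i ↦
    (l.idxFun i).elim (LinearMap.snd F _ F) (fun a ↦ a ∘ₗ LinearMap.fst F _ F)
  let Ψ : (Fin d → F) × F →ₗ[F] E := J ∘ₗ (LinearMap.fst F _ F).prod q
  have hΨ : Function.Injective Ψ := by
    refine hJ.comp fun x y hxy ↦ ?_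
    obtain ⟨i, hi⟩ := l.proper
    have h1 : x.1 = y.1 := (Prod.ext_iff.1 hxy).1
    have h2 : q x i = q y i := congrFun (Prod.ext_iff.1 hxy).2 i
    exact Prod.ext h1 (by simpa [q, hi] using h2)
  have hgraph : ∀ g : (Fin d → F) →ₗ[F] F,
      Ψ ∘ₗ LinearMap.id.prod g = J ∘ₗ LinearMap.id.prod (LinearMap.pi (l g)) := by
    intro g
    refine LinearMap.ext fun b ↦ congrArg J (Prod.ext rfl (funext fun i ↦ ?_))
    cases hi : l.idxFun i <;> simp [q, hi]
  have hΨU : LinearMap.range Ψ ≤ U := (LinearMap.range_comp_le_range _ _).trans hJU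
  have hcolor : ∀ T₀ : Submodule F ((Fin d → F) × F), ((0, 1) : (Fin d → F) × F) ∉ T₀ →
      c (T₀.map Ψ) = χ (T₀.map (LinearMap.fst F _ F)) := by
    intro T₀ h
    obtain ⟨g, hg⟩ := Submodule.exists_eq_map_prod_of_notMem h
    conv_lhs => rw [hg, ← Submodule.map_comp, hgraph]
    exact congrFun (hχ g) _
  have hspan : LinearMap.range (Ψ ∘ₗ LinearMap.inl F _ F) ⊔ F ∙ Ψ (0, 1) ≤ LinearMap.range Ψ :=
    sup_le (LinearMap.range_comp_le_range _ _)
      ((Submodule.span_singleton_le_iff_mem _ _).2 ⟨_, rfl⟩)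
  have hfst : ∀ T₀ : Submodule F ((Fin d → F) × F),
      (T₀ ⊔ F ∙ (0, 1)).map (LinearMap.fst F _ F) = T₀.map (LinearMap.fst F _ F) := by
    intro T₀
    simp [Submodule.map_sup, Submodule.map_span]
  refine ⟨LinearMap.range (Ψ ∘ₗ LinearMap.inl F _ F), Ψ (0, 1),
    (LinearMap.range_comp_le_range _ _).trans hΨU, hΨU ⟨_, rfl⟩, ?_, ?_, ?_⟩
  · rintro ⟨b, hb⟩
    simpa using congrArg Prod.snd (hΨ hb)
  · have hinj : Function.Injective (Ψ ∘ₗ LinearMap.inl F (Fin d → F) F) :=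
      hΨ.comp LinearMap.inl_injective
    simp [LinearMap.finrank_range_of_inj hinj]
  · intro T T' hT hT' he he' hTT'
    have hlift : ∀ T ≤ LinearMap.range Ψ, ∃ T₀ : Submodule F ((Fin d → F) × F), T₀.map Ψ = T :=
      fun T h ↦ ⟨T.comap Ψ, Submodule.map_comap_eq_of_le h⟩
    obtain ⟨T₀, rfl⟩ := hlift T (hT.trans hspan)
    obtain ⟨T₁, rfl⟩ := hlift T' (hT'.trans hspan)
    rw [hcolor T₀ fun h ↦ he ⟨_, h, rfl⟩, hcolor T₁ fun h ↦ he' ⟨_, h, rfl⟩]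
    have hpre : T₀ ⊔ F ∙ (0, 1) = T₁ ⊔ F ∙ (0, 1) := by
      apply Submodule.map_injective_of_injective hΨ
      simpa [Submodule.map_sup, Submodule.map_span] using hTT'
    rw [← hfst T₀, hpre, hfst]

/-- `VectorRamsey F κ k f` says that for every `κ`-coloring of the subspaces of a large enough
space there are a color `i` and a subspace of dimension `f i` all of whose `k`-dimensional
subspaces have color `i`. -/
def VectorRamsey (κ : Type v) (k : ℕ) (f : κ → ℕ) : Prop :=
  ∃ m : ℕ, ∀ (E : Type u) [AddCommGroup E] [Module F E] [FiniteDimensional F E]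
    (U : Submodule F E), m ≤ finrank F U → ∀ c : Submodule F E → κ,
    ∃ (i : κ) (V : Submodule F E), V ≤ U ∧ finrank F V = f i ∧
      ∀ W ≤ V, finrank F W = k → c W = i

variable {F}

/-- Induction on `∑ i, f i`: a subspace `V` found for `f` lowered by one at `a` either already
suffices or has color `a`, and then adjoining `e` regains the lost dimension. -/
theorem VectorRamsey.succ {κ : Type v} [Finite κ] {k : ℕ}
    (ih : ∀ n, VectorRamsey F κ k fun _ ↦ n) (f : κ → ℕ) : VectorRamsey F κ (k + 1) f := by
  classical
  cases nonempty_fintype κ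
  generalize hN : ∑ i, f i = N
  induction N generalizing f with
  | zero =>
    refine ⟨0, fun E _ _ _ U _ c ↦ ⟨c ⊥, ⊥, bot_le, ?_, ?_⟩⟩
    · rw [finrank_bot, (Finset.sum_eq_zero_iff.1 hN) _ (Finset.mem_univ _)]
    · rintro W hW -
      rw [le_bot_iff.1 hW]
  | succ N ihN =>
    by_cases hf : ∃ i, f i = 0
    · obtain ⟨i, hi⟩ := hf
      refine ⟨0, fun E _ _ _ U _ c ↦ ⟨i, ⊥, bot_le, by simp [hi], fun W hW hk ↦ ?_⟩⟩
      rw [le_bot_iff.1 hW, finrank_bot] at hk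
      omega
    push Not at hf
    have hupd : ∀ a, VectorRamsey F κ (k + 1) (Function.update f a (f a - 1)) := by
      refine fun a ↦ ihN _ ?_
      have h1 := Finset.sum_update_of_mem (Finset.mem_univ a) f (f a - 1)
      have h2 := Finset.add_sum_erase Finset.univ f (Finset.mem_univ a)
      rw [← Finset.erase_eq] at h1
      have := hf a
      omega
    choose M hM using hupd
    obtain ⟨d, hd⟩ := ih (Finset.univ.sup M)
    obtain ⟨m, hm⟩ := exists_coloring_factors_through_quotient F κ d
    refine ⟨m, fun E _ _ _ U hU c ↦ ?_⟩
    obtain ⟨B, e, hBU, heU, heB, hBd, hc⟩ := hm E U hU c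
    obtain ⟨a, B', hB'B, hB'd, hB'⟩ := hd E B hBd.ge fun T ↦ c (T ⊔ F ∙ e)
    obtain ⟨i, V, hVB', hVd, hV⟩ := hM a E B' (hB'd ▸ Finset.le_sup (Finset.mem_univ a)) c
    by_cases hia : i = a
    swap
    · exact ⟨i, V, hVB'.trans (hB'B.trans hBU), by simpa [hia] using hVd, hV⟩
    subst hia
    have heV : e ∉ V := fun h ↦ heB (hB'B (hVB' h))
    have hVB : V ⊔ F ∙ e ≤ B ⊔ F ∙ e := sup_le_sup_right (hVB'.trans hB'B) _
    refine ⟨i, V ⊔ F ∙ e, sup_le (hVB'.trans (hB'B.trans hBU))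
      ((Submodule.span_singleton_le_iff_mem _ _).2 heU), ?_, fun W hW hk ↦ ?_⟩
    · rw [Submodule.finrank_sup_span_singleton heV, hVd, Function.update_self]
      have := hf i
      omega
    by_cases heW : e ∈ W
    · have hWe := Submodule.inf_sup_eq_of_le_sup
        ((Submodule.span_singleton_le_iff_mem _ _).2 heW) hW
      have hfr := Submodule.finrank_sup_span_singleton
        (p := W ⊓ V) (v := e) fun h ↦ heV h.2
      rw [hWe, hk] at hfr
      rw [← hWe]
      exact hB' _ (inf_le_right.trans hVB') (by omega)
    -- `W` is exchanged for the trace of `W ⊔ ⟨e⟩` on `V`, which has the same dimension and the same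
    -- image modulo `e`.
    · have hWe := Submodule.inf_sup_eq_of_le_sup (V := V) (L := F ∙ e) (T := W ⊔ F ∙ e)
        le_sup_right (sup_le hW le_sup_right)
      have hfr := Submodule.finrank_sup_span_singleton
        (p := (W ⊔ F ∙ e) ⊓ V) (v := e) fun h ↦ heV h.2
      rw [hWe, Submodule.finrank_sup_span_singleton heW, hk] at hfr
      rw [hc W ((W ⊔ F ∙ e) ⊓ V) (hW.trans hVB) (inf_le_right.trans (le_sup_left.trans hVB)) heW
        (fun h ↦ heV h.2) hWe.symm]
      exact hV _ inf_le_right (by omega)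

theorem vectorRamsey_const (κ : Type v) [Finite κ] (k n : ℕ) :
    VectorRamsey F κ k fun _ ↦ n := by
  induction k generalizing n with
  | zero =>
    refine ⟨n, fun E _ _ _ U hU c ↦ ?_⟩
    obtain ⟨V, hVU, hV⟩ := Submodule.exists_le_finrank_eq hU
    refine ⟨c ⊥, V, hVU, hV, fun W _ hW ↦ ?_⟩
    rw [Submodule.finrank_eq_zero.1 hW]
  | succ k ih => exact VectorRamsey.succ ih _

theorem mainTheorem7 (F : Type*) [Field F] [Finite F] (k n s : ℕ) :
    ∃ m : ℕ, ∀ c : {W : Submodule F (Fin m → F) // Module.finrank F W = k} → Fin s,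
      ∃ V : Submodule F (Fin m → F), Module.finrank F V = n ∧
        ∃ i : Fin s, ∀ W : {W : Submodule F (Fin m → F) // Module.finrank F W = k},
          W.1 ≤ V → c W = i := by
  classical
  obtain ⟨m, hm⟩ := vectorRamsey_const (F := F) (Fin s) k n
  -- Dimension at least `k` provides some `W₀`, whose color is the default for other dimensions;
  -- `Fin s` itself may be empty.
  refine ⟨max m k, fun c ↦ ?_⟩
  obtain ⟨W₀, -, hW₀⟩ := Submodule.exists_le_finrank_eq (n := k)
    (U := (⊤ : Submodule F (Fin (max m k) → F))) (by simp)
  obtain ⟨i, V, -, hV, hi⟩ := hm (Fin (max m k) → F) ⊤ (by simp)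
    fun W ↦ if h : finrank F W = k then c ⟨W, h⟩ else c ⟨W₀, hW₀⟩
  refine ⟨V, hV, i, fun W hWV ↦ ?_⟩
  simpa [W.2] using hi W.1 hWV W.2
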